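/- Let $k \ge 4$ be an even integer and let $d \ge k/2$ be an integer. Then there is an integer $n_0 = n_0(k,d)$ such that the following holds for every $n \ge n_0$. A $k$-graph on a finite vertex set $V$ is a family of $k$-element subsets of $V$, called its edges; the minimum $d$-degree $\delta_d(\mathcal{H})$ of a $k$-graph $\mathcal{H}$ on $V$ is the minimum, over all $d$-element sets $S \subseteq V$, of the number of edges of $\mathcal{H}$ containing $S$. For a partition $V = A \,\dot\cup\, B$ with $|V| = n$, let $\mathcal{B}_{n,k}(A,B)$ (respectively $\overline{\mathcal{B}}_{n,k}(A,B)$) be the $k$-graph on $V$ whose edges are all $k$-element subsets $e \subseteq V$ with $|e \cap A|$ odd (respectively even). Let $\mathcal{H}$ be a $k$-graph on a vertex set $V$ with $|V| = n$, and let $V = A \,\dot\cup\, B$ be a partition with $|A|, |B| \ge 0.4\,n$. 1. If $\delta_d(\mathcal{H}) > \delta_d(\mathcal{B}_{n,k}(A,B))$, then $\mathcal{H} \cap \overline{\mathcal{B}}_{n,k}(A,B)$ contains two edges $e_1, e_2$ with $|e_1 \cap e_2| \in \{0, k/2\}$. 2. If $\delta_d(\mathcal{H}) > \delta_d(\overline{\mathcal{B}}_{n,k}(A,B))$,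 then $\mathcal{H} \cap \mathcal{B}_{n,k}(A,B)$ contains two edges $e_1, e_2$ with $|e_1 \cap e_2| \in \{0, k/2\}$. -/

import Mathlib

/-- A `k`-uniform hypergraph (`k`-graph) with finite vertex set `V`:
a family of `k`-element subsets of `V`. -/
@[ext]
structure KGraph (V : Type*) [Fintype V] (k : ℕ) where
  /-- The edge set. -/
  edges : Finset (Finset V)
  edges_subset : edges ⊆ Finset.powersetCard k Finset.univ

namespace KGraph

variable {V : Type*} [Fintype V] [DecidableEq V] {k : ℕ}

/-- The degree of a vertex set `S`: the number of edges containing `S`. -/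
def degree (H : KGraph V k) (S : Finset V) : ℕ :=
  (H.edges.filter (fun e => S ⊆ e)).card

/-- The minimum `d`-degree: the minimum of `degree S` over all `d`-element vertex sets `S`.
(The minimum is over a nonempty set as soon as `d ≤ |V|`.) -/
noncomputable def minDegree (H : KGraph V k) (d : ℕ) : ℕ :=
  sInf {m : ℕ | ∃ S : Finset V, S.card = d ∧ H.degree S = m}

/-- The common edges of two `k`-graphs on the same vertex set. -/
def inter (H K : KGraph V k) : KGraph V k where
  edges := H.edges ∩ K.edges
  edges_subset := Finset.inter_subset_left.trans H.edges_subset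

/-- The `k`-graph `B_{n,k}(A, B)`, where `B` is the complement of `A` in the vertex set:
its edges are all `k`-sets meeting `A` in an odd number of vertices. -/
def oddGraph (k : ℕ) (A : Finset V) : KGraph V k where
  edges := (Finset.powersetCard k Finset.univ).filter (fun e => Odd (e ∩ A).card)
  edges_subset := Finset.filter_subset _ _

/-- The `k`-graph `B̄_{n,k}(A, B)`, where `B` is the complement of `A` in the vertex set:
its edges are all `k`-sets meeting `A` in an even number of vertices. -/
def evenGraph (k : ℕ) (A : Finset V) : KGraph V k where
  edges := (Finset.powersetCard k Finset.univ).filter (fun e => Even (e ∩ A).card)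
  edges_subset := Finset.filter_subset _ _

end KGraph

/-! Write k = 2m, let G be the parity graph with the smaller minimum degree, and let G' be the other
one. Degrees in G depend only on how a set splits over A and its complement. So every d-set with the
same split as a minimiser for G lies in an edge of H outside G, that is, in an edge of H ∩ G'. As d
≥ m, one can choose m large disjoint sets, each inside A or inside its complement, such that every
transversal extends to such a d-set (`exists_card_inter_of_minDegree_lt`).

Each transversal x thus lies in an edge with m further vertices t_1(x), ..., t_m(x). By a canonical
Ramsey argument (`forcible_canonical`), on a large subgrid each t_j either ignores or determines
each coordinate of x. Let J_j be the set of coordinates that t_j determines. Freezing the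
coordinates in Q and varying the others generically yields two edges meeting in exactly |Q| + #{j :
J_j ⊆ Q} vertices.

If no J_j is empty, Q = ∅ gives 0. Otherwise fewer than m of the J_j are nonempty, and the
Frankl–Katona theorem (`exists_card_add_card_filter_subset_eq`) gives a Q with intersection size m.
-/

/-! ### The Frankl–Katona theorem -/

/-- Weighted double counting of the non-incident pairs of a bipartite relation, as in Conway's
proof of the de Bruijn–Erdős theorem. -/
lemma card_le_card_of_nonincident {α ι : Type*} (X : Finset α) (I : Finset ι)
    (r : α → ι → Prop) [∀ x i, Decidable (r x i)]
    (hne : ∀ x ∈ X, ∃ i ∈ I, r x i)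
    (hle : ∀ x ∈ X, ∀ i ∈ I, r x i →
      (X.filter (fun y => r y i)).card ≤ (I.filter (fun j => r x j)).card) :
    X.card ≤ I.card := by
  have h1 : (X.card : ℚ) =
      ∑ x ∈ X, ∑ i ∈ I, if r x i then ((I.filter (fun j => r x j)).card : ℚ)⁻¹ else 0 := by
    rw [Finset.card_eq_sum_ones, Nat.cast_sum]
    refine Finset.sum_congr rfl fun x hx => ?_
    obtain ⟨i, hi, hr⟩ := hne x hx
    have hpos : (I.filter (fun j => r x j)).card ≠ 0 :=
      Finset.card_ne_zero_of_mem (Finset.mem_filter.2 ⟨hi, hr⟩)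
    rw [← Finset.sum_filter, Finset.sum_const, nsmul_eq_mul, mul_inv_cancel₀ (by exact_mod_cast hpos)]
    simp
  have h2 : ∑ i ∈ I, ∑ x ∈ X, (if r x i then ((X.filter (fun y => r y i)).card : ℚ)⁻¹ else 0)
      ≤ I.card := by
    rw [Finset.card_eq_sum_ones, Nat.cast_sum]
    refine Finset.sum_le_sum fun i _ => ?_
    rw [← Finset.sum_filter, Finset.sum_const, nsmul_eq_mul]
    simpa using mul_inv_le_one
  have h3 : (X.card : ℚ) ≤ I.card := by
    rw [h1, Finset.sum_comm]
    refine le_trans (Finset.sum_le_sum fun i hi => Finset.sum_le_sum fun x hx => ?_) h2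
    split_ifs with hr
    · have hpos : 0 < (X.filter (fun y => r y i)).card :=
        Finset.card_pos.2 ⟨x, Finset.mem_filter.2 ⟨hx, hr⟩⟩
      exact inv_anti₀ (by exact_mod_cast hpos) (by exact_mod_cast hle x hx i hi hr)
    · exact le_rfl
  exact_mod_cast h3

/-- A form of the Frankl–Katona theorem: given fewer than `|X|` nonempty subsets `J i` of `X`,
every `τ < |X|` is of the form `|Q| + #{i | J i ⊆ Q}` for some `Q ⊆ X`. -/
theorem exists_card_add_card_filter_subset_eq {α ι : Type*} [DecidableEq α] (n : ℕ) :
    ∀ (X : Finset α) (I : Finset ι) (J : ι → Finset α) (τ : ℕ), X.card = n →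
      (∀ i ∈ I, (J i).Nonempty ∧ J i ⊆ X) → I.card < X.card → τ < X.card →
      ∃ Q ⊆ X, Q.card + (I.filter (fun i => J i ⊆ Q)).card = τ := by
  induction n using Nat.strong_induction_on with
  | _ n ih =>
  intro X I J τ hXn hJ hIX hτ
  by_cases hτ' : τ + 1 < X.card
  · rcases I.eq_empty_or_nonempty with rfl | ⟨i₀, hi₀⟩
    · obtain ⟨Q, hQ, hQc⟩ := Finset.exists_subset_card_eq hτ.le
      exact ⟨Q, hQ, by simpa using hQc⟩
    -- Delete x together with all sets containing it: `|X|` drops by one and `|I|` by at least one,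
    -- so `|I| < |X|` survives.
    · obtain ⟨x, hx⟩ := (hJ i₀ hi₀).1
      have hxX := (hJ i₀ hi₀).2 hx
      have hlt : (I.filter (fun i => x ∉ J i)).card < I.card :=
        Finset.card_lt_card (Finset.filter_ssubset.2 ⟨i₀, hi₀, by simpa using hx⟩)
      have hc := Finset.card_erase_of_mem hxX
      obtain ⟨Q, hQ, hQc⟩ := ih (X.erase x).card (by omega) (X.erase x)
        (I.filter (fun i => x ∉ J i)) J τ rfl
        (fun i hi => by
          rw [Finset.mem_filter] at hi
          exact ⟨(hJ i hi.1).1, Finset.subset_erase.2 ⟨(hJ i hi.1).2, hi.2⟩⟩)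
        (by omega) (by omega)
      have hxQ : x ∉ Q := fun h => by simpa using hQ h
      refine ⟨Q, hQ.trans (Finset.erase_subset _ _), ?_⟩
      rw [← hQc, Finset.filter_filter]
      congr 2
      exact Finset.filter_congr fun i _ => ⟨fun h => ⟨fun hxi => hxQ (h hxi), h⟩, fun h => h.2⟩
  -- From here on τ = |X| - 1. A point common to all the sets is simply left out of Q.
  by_cases hall : ∃ x ∈ X, ∀ i ∈ I, x ∈ J i
  · obtain ⟨x, hx, hxi⟩ := hall
    refine ⟨X.erase x, Finset.erase_subset _ _, ?_⟩
    rw [Finset.filter_false_of_mem, Finset.card_erase_of_mem hx, Finset.card_empty]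
    · omega
    · intro i hi h
      simpa using h (hxi i hi)
  push Not at hall
  have hdeg : ∀ x, (I.filter (fun i => x ∈ J i)).card + (I.filter (fun i => x ∉ J i)).card
      = I.card := fun x => Finset.card_filter_add_card_filter_not _
  -- The inequality says that fewer than |X \ J i| sets avoid x. Then put W = J i into Q, keep x
  -- out, and recurse on the traces outside W of the sets avoiding x. At least one set, J i itself,
  -- lies inside W, which pays for the loss of x.
  by_cases hbig : ∃ x ∈ X, ∃ i ∈ I, x ∉ J i ∧
      I.card + (J i).card + 1 ≤ (I.filter (fun j => x ∈ J j)).card + X.card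
  · obtain ⟨x, hx, i, hi, hxi, hle⟩ := hbig
    set W := J i with hW
    have hWX : W ⊆ X := (hJ i hi).2
    have hsplit : (I.filter (fun j => x ∉ J j)).card = (I.filter (fun j => J j ⊆ W)).card
        + (I.filter (fun j => x ∉ J j ∧ ¬ J j ⊆ W)).card := by
      rw [← Finset.card_filter_add_card_filter_not (s := I.filter (fun j => x ∉ J j))
        (fun j => J j ⊆ W), Finset.filter_filter, Finset.filter_filter]
      congr 2
      exact Finset.filter_congr fun j _ => ⟨fun h => h.2, fun h => ⟨fun hxj => hxi (h hxj), h⟩⟩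
    have hc1 : 0 < (I.filter (fun j => J j ⊆ W)).card :=
      Finset.card_pos.2 ⟨i, Finset.mem_filter.2 ⟨hi, subset_rfl⟩⟩
    have hxW : x ∈ X \ W := Finset.mem_sdiff.2 ⟨hx, hxi⟩
    have hX' : ((X \ W).erase x).card + W.card + 1 = X.card := by
      have h1 := Finset.card_sdiff_add_card_eq_card hWX
      have h2 := Finset.card_erase_add_one hxW
      omega
    have hd := hdeg x
    obtain ⟨Q, hQ, hQc⟩ := ih ((X \ W).erase x).card (by omega) ((X \ W).erase x)
      (I.filter (fun j => x ∉ J j ∧ ¬ J j ⊆ W)) (fun j => J j \ W)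
      (τ - W.card - (I.filter (fun j => J j ⊆ W)).card) rfl
      (fun j hj => by
        rw [Finset.mem_filter] at hj
        refine ⟨Finset.sdiff_nonempty.2 hj.2.2, Finset.subset_erase.2
          ⟨Finset.sdiff_subset_sdiff (hJ j hj.1).2 subset_rfl, ?_⟩⟩
        simp [hj.2.1])
      (by omega) (by omega)
    have hxQ : x ∉ Q := fun h => by simpa using hQ h
    have hQX : Q ⊆ X \ W := hQ.trans (Finset.erase_subset _ _)
    have hdisj : Disjoint Q W := Finset.disjoint_of_subset_left hQX Finset.sdiff_disjoint
    refine ⟨Q ∪ W, Finset.union_subset (hQX.trans Finset.sdiff_subset) hWX, ?_⟩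
    rw [Finset.card_union_of_disjoint hdisj]
    have hf : (I.filter (fun j => J j ⊆ Q ∪ W)).card = (I.filter (fun j => J j ⊆ W)).card +
        ((I.filter (fun j => x ∉ J j ∧ ¬ J j ⊆ W)).filter (fun j => J j \ W ⊆ Q)).card := by
      rw [← Finset.card_filter_add_card_filter_not (s := I.filter (fun j => J j ⊆ Q ∪ W))
        (fun j => J j ⊆ W), Finset.filter_filter, Finset.filter_filter, Finset.filter_filter]
      congr 2
      · exact Finset.filter_congr fun j _ =>
          ⟨fun h => h.2, fun h => ⟨h.trans Finset.subset_union_right, h⟩⟩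
      · refine Finset.filter_congr fun j _ => ?_
        have hiff : J j \ W ⊆ Q ↔ J j ⊆ Q ∪ W := by
          rw [Finset.union_comm]; exact sdiff_le_iff
        rw [hiff]
        refine ⟨fun h => ⟨⟨fun hxj => ?_, h.2⟩, h.1⟩, fun h => ⟨h.2, h.1.2⟩⟩
        rcases Finset.mem_union.1 (h.1 hxj) with h' | h'
        · exact hxQ h'
        · exact hxi h'
    omega
  · push Not at hbig
    exfalso
    -- Now every non-incident pair (x, i) has at least as many sets missing x as points missing J i,
    -- so weighted counting gives |X| ≤ |I|.
    have := card_le_card_of_nonincident X I (fun x i => x ∉ J i) hall (by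
      intro x hx i hi hxi
      have h1 := hbig x hx i hi hxi
      have h2 := hdeg x
      have h3 : (X.filter (fun y => y ∉ J i)).card + (J i).card = X.card := by
        rw [Finset.filter_notMem_eq_sdiff]
        exact Finset.card_sdiff_add_card_eq_card (hJ i hi).2
      omega)
    omega

/-! ### Canonical Ramsey theory on grids -/

/-- A property of grids `Y : ι → Finset ℕ`, depending on a parameter, is *forcible* if every
sufficiently large grid has a large subgrid with the property, uniformly in the parameter. -/
def Forcible {ι α : Type*} (P : α → (ι → Finset ℕ) → Prop) : Prop :=
  ∀ M : ℕ, ∃ N : ℕ, ∀ (a : α) (X : ι → Finset ℕ), (∀ i, N ≤ (X i).card) →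
    ∃ Y : ι → Finset ℕ, (∀ i, Y i ⊆ X i) ∧ (∀ i, M ≤ (Y i).card) ∧ P a Y

/-- A property of grids is *hereditary* if it passes to subgrids. -/
def HereditaryOnGrids {ι α : Type*} (P : α → (ι → Finset ℕ) → Prop) : Prop :=
  ∀ (a : α) (X Y : ι → Finset ℕ), (∀ i, Y i ⊆ X i) → P a X → P a Y

/-- Properties are forced one after another on shrinking grids; heredity preserves those already
obtained. -/
lemma Forcible.forall_mem {ι α κ : Type*} [DecidableEq κ] {P : κ → α → (ι → Finset ℕ) → Prop}
    (hP : ∀ c, Forcible (P c)) (hher : ∀ c, HereditaryOnGrids (P c)) (s : Finset κ) :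
    Forcible (fun a Y => ∀ c ∈ s, P c a Y) := by
  induction s using Finset.induction_on with
  | empty => exact fun M => ⟨M, fun a X hX => ⟨X, fun i => subset_rfl, hX, by simp⟩⟩
  | insert c s _ ih =>
    intro M
    obtain ⟨N₁, h₁⟩ := hP c M
    obtain ⟨N₂, h₂⟩ := ih N₁
    refine ⟨N₂, fun a X hX => ?_⟩
    obtain ⟨Y, hYX, hY, hYs⟩ := h₂ a X hX
    obtain ⟨Z, hZY, hZ, hZc⟩ := h₁ a Y hY
    refine ⟨Z, fun i => (hZY i).trans (hYX i), hZ, fun d hd => ?_⟩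
    rcases Finset.mem_insert.1 hd with rfl | hd
    · exact hZc
    · exact hher d a Y Z hZY (hYs d hd)

/-- On the grid `Y`, the function `f` does not depend on the coordinate `i`. -/
def IndepCoord {ι β : Type*} [DecidableEq ι] (i : ι) (f : (ι → ℕ) → β) (Y : ι → Finset ℕ) : Prop :=
  ∀ x : ι → ℕ, (∀ j, x j ∈ Y j) → ∀ w ∈ Y i, f (Function.update x i w) = f x

/-- On the grid `Y`, the values of `f` determine the coordinate `i`. -/
def DeterminesCoord {ι β : Type*} (i : ι) (f : (ι → ℕ) → β) (Y : ι → Finset ℕ) : Prop :=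
  ∀ x y : ι → ℕ, (∀ j, x j ∈ Y j) → (∀ j, y j ∈ Y j) → f x = f y → x i = y i

lemma hereditaryOnGrids_indepCoord {ι β : Type*} [DecidableEq ι] (i : ι) :
    HereditaryOnGrids (fun f : (ι → ℕ) → β => IndepCoord i f) :=
  fun _ _ _ hYX h x hx w hw => h x (fun j => hYX j (hx j)) w (hYX i hw)

lemma hereditaryOnGrids_determinesCoord {ι β : Type*} (i : ι) :
    HereditaryOnGrids (fun f : (ι → ℕ) → β => DeterminesCoord i f) :=
  fun _ _ _ hYX h x y hx hy => h x y (fun j => hYX j (hx j)) (fun j => hYX j (hy j))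

/-- Move from x to y one coordinate at a time: a step in D changes nothing, and a step outside D
does not affect f. -/
lemma eq_of_indepCoord {ι β : Type*} [Fintype ι] [DecidableEq ι] {f : (ι → ℕ) → β}
    {Y : ι → Finset ℕ} {D : Finset ι}
    (h : ∀ i ∉ D, IndepCoord i f Y) {x y : ι → ℕ} (hx : ∀ j, x j ∈ Y j) (hy : ∀ j, y j ∈ Y j)
    (hxy : ∀ i ∈ D, x i = y i) : f x = f y := by
  have key : ∀ s : Finset ι, f (s.piecewise y x) = f x := by
    intro s
    induction s using Finset.induction_on with
    | empty => simp
    | insert i s _ ih =>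
      rw [Finset.piecewise_insert]
      have hmem : ∀ j, s.piecewise y x j ∈ Y j := fun j => by
        by_cases hj : j ∈ s <;> simp [hj, hx j, hy j]
      by_cases hi : i ∈ D
      · rw [← ih]
        congr 1
        rw [Function.update_eq_self_iff]
        by_cases his : i ∈ s <;> simp [his, hxy i hi]
      · rw [h i hi _ hmem _ (hy i), ih]
  have := key Finset.univ
  simpa using this.symm

/-- A finite set of at most `(M + 1) ^ |ι|` points represents all lines in direction `i` of a subgrid. -/
lemma exists_line_representatives {ι : Type*} [Fintype ι] [DecidableEq ι] (i : ι) (M : ℕ)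
    (X : ι → Finset ℕ) (hX : ∀ j, M ≤ (X j).card) :
    ∃ (X' : ι → Finset ℕ) (L : Finset (ι → ℕ)), (∀ j, X' j ⊆ X j) ∧ X' i = X i ∧
      (∀ j, j ≠ i → (X' j).card = M) ∧ L.card ≤ (M + 1) ^ Fintype.card ι ∧
      ∀ x : ι → ℕ, (∀ j, x j ∈ X' j) → Function.update x i 0 ∈ L := by
  choose T hT hTc using fun j => Finset.exists_subset_card_eq (hX j)
  refine ⟨Function.update T i (X i), Fintype.piFinset (Function.update T i {0}), ?_, by simp,
    ?_, ?_, ?_⟩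
  · intro j
    by_cases hj : j = i
    · subst hj; simp
    · simp [hj, hT j]
  · intro j hj
    simp [hj, hTc j]
  · rw [Fintype.card_piFinset]
    refine (Finset.prod_le_pow_card _ _ (M + 1) fun j _ => ?_)
    by_cases hj : j = i
    · subst hj; simp
    · simp [hj, hTc j]
  · intro x hx
    rw [Fintype.mem_piFinset]
    intro j
    by_cases hj : j = i
    · subst hj; simp
    · simpa [hj] using hx j

/-- Each value of coordinate i induces a two-colouring of the boundedly many lines in direction i.
By pigeonhole, many values induce the same one. -/
lemma forcible_indepCoord_prop {ι : Type*} [Fintype ι] [DecidableEq ι] (i : ι) :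
    Forcible (fun f : (ι → ℕ) → Prop => IndepCoord i f) := by
  classical
  intro M
  refine ⟨M * 2 ^ ((M + 1) ^ Fintype.card ι) + M, fun f X hX => ?_⟩
  obtain ⟨X', L, hX'X, hX'i, hX'c, hLc, hL⟩ :=
    exists_line_representatives i M X fun j => le_trans (Nat.le_add_left _ _) (hX j)
  have hmaps : ∀ w ∈ X i, L.filter (fun l => f (Function.update l i w)) ∈ L.powerset :=
    fun w _ => Finset.mem_powerset.2 (Finset.filter_subset _ _)
  obtain ⟨c, -, hc⟩ := Finset.exists_le_card_fiber_of_mul_le_card_of_maps_to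
    (n := M) hmaps ⟨∅, Finset.empty_mem_powerset _⟩ (by
      rw [Finset.card_powerset, mul_comm]
      exact le_trans (Nat.mul_le_mul_left _ (Nat.pow_le_pow_right (by norm_num) hLc))
        (le_trans (Nat.le_add_right _ _) (hX i)))
  set F := (X i).filter (fun w => L.filter (fun l => f (Function.update l i w)) = c) with hF
  have hsub : ∀ j, Function.update X' i F j ⊆ X' j := by
    intro j
    by_cases hj : j = i
    · subst hj; simp [hX'i, hF]
    · simp [hj]
  refine ⟨Function.update X' i F, fun j => (hsub j).trans (hX'X j), ?_, ?_⟩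
  · intro j
    by_cases hj : j = i
    · subst hj; simpa using hc
    · simp [hj, hX'c j hj]
  · intro x hx w hw
    have hxi : x i ∈ F := by simpa using hx i
    have hwF : w ∈ F := by simpa using hw
    have hl := hL x fun j => hsub j (hx j)
    have h1 := (Finset.mem_filter.1 hxi).2
    have h2 := (Finset.mem_filter.1 hwF).2
    have h3 : (Function.update x i 0 ∈ L.filter (fun l => f (Function.update l i w))) ↔
        Function.update x i 0 ∈ L.filter (fun l => f (Function.update l i (x i))) := by
      rw [h1, h2]
    simpa [hl] using h3

/-- Every two-colouring of a large grid is constant on a large subgrid. -/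
lemma forcible_const_prop (ι : Type*) [Fintype ι] :
    Forcible (fun (f : (ι → ℕ) → Prop) (Y : ι → Finset ℕ) =>
      ∀ x y : ι → ℕ, (∀ j, x j ∈ Y j) → (∀ j, y j ∈ Y j) → (f x ↔ f y)) := by
  classical
  intro M
  obtain ⟨N, hN⟩ := Forcible.forall_mem (P := fun (i : ι) (f : (ι → ℕ) → Prop) => IndepCoord i f)
    forcible_indepCoord_prop hereditaryOnGrids_indepCoord Finset.univ M
  refine ⟨N, fun f X hX => ?_⟩
  obtain ⟨Y, hYX, hY, h⟩ := hN f X hX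
  refine ⟨Y, hYX, hY, fun x y hx hy => ?_⟩
  exact iff_of_eq (eq_of_indepCoord (D := ∅) (fun i _ => h i (Finset.mem_univ i)) hx hy (by simp))

/-- Either g takes many values, and one preimage of each is kept, or some fibre is large. -/
lemma exists_const_or_injOn (M : ℕ) (g : ℕ → ℕ) (X : Finset ℕ) (hX : M * M ≤ X.card) :
    ∃ Y ⊆ X, M ≤ Y.card ∧ ((∀ v ∈ Y, ∀ w ∈ Y, g v = g w) ∨ Set.InjOn g Y) := by
  by_cases h : M ≤ (X.image g).card
  · obtain ⟨Y, hY, hinj, himg⟩ := Finset.exists_subset_injOn_image_eq_of_surjOn (f := g) (↑X)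
      (X.image g) (by simpa using Set.surjOn_image g (X : Set ℕ))
    refine ⟨Y, by exact_mod_cast hY, ?_, Or.inr hinj⟩
    rwa [← Finset.card_image_of_injOn hinj, himg]
  · push Not at h
    rcases X.eq_empty_or_nonempty with rfl | hne
    · refine ⟨∅, by simp, ?_, by simp⟩
      simp at hX
      simp [hX]
    obtain ⟨y, -, hy⟩ := Finset.exists_le_card_fiber_of_mul_le_card_of_maps_to
      (f := g) (t := X.image g) (n := M) (s := X) (fun a ha => Finset.mem_image_of_mem g ha)
      (hne.image g) (le_trans (Nat.mul_le_mul_right _ h.le) hX)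
    refine ⟨_, Finset.filter_subset _ _, hy, Or.inl ?_⟩
    intro v hv w hw
    rw [(Finset.mem_filter.1 hv).2, (Finset.mem_filter.1 hw).2]

lemma exists_forall_const_or_injOn {β : Type*} (c : ℕ) :
    ∀ M : ℕ, ∃ N : ℕ, ∀ (L : Finset β) (g : β → ℕ → ℕ) (X : Finset ℕ), L.card ≤ c → N ≤ X.card →
      ∃ Y ⊆ X, M ≤ Y.card ∧
        ∀ l ∈ L, (∀ v ∈ Y, ∀ w ∈ Y, g l v = g l w) ∨ Set.InjOn (g l) Y := by
  classical
  induction c with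
  | zero =>
    refine fun M => ⟨M, fun L g X hL hX => ⟨X, subset_rfl, hX, ?_⟩⟩
    have : L = ∅ := by simpa using hL
    simp [this]
  | succ c ih =>
    intro M
    obtain ⟨N, hN⟩ := ih M
    refine ⟨N * N + N, fun L g X hL hX => ?_⟩
    rcases L.eq_empty_or_nonempty with rfl | ⟨l, hl⟩
    · obtain ⟨Y, hYX, hY, -⟩ := hN ∅ g X (by simp) (by omega)
      exact ⟨Y, hYX, hY, by simp⟩
    obtain ⟨Y, hYX, hY, hYl⟩ := exists_const_or_injOn N (g l) X (by omega)
    obtain ⟨Z, hZY, hZ, hZL⟩ := hN (L.erase l) g Y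
      (by rw [Finset.card_erase_of_mem hl]; omega) hY
    refine ⟨Z, hZY.trans hYX, hZ, fun l' hl' => ?_⟩
    by_cases hll : l' = l
    · subst hll
      exact hYl.imp (fun h v hv w hw => h v (hZY hv) w (hZY hw)) (fun h => h.mono hZY)
    · exact hZL l' (Finset.mem_erase.2 ⟨hll, hl'⟩)

/-- A symmetric relation with all neighbourhoods of size at most `D` has large independent sets. -/
lemma exists_independent_subset {α : Type*} (R : α → α → Prop) [DecidableRel R]
    (hR : ∀ a b, R a b → R b a) (D : ℕ) (M : ℕ) :
    ∀ X : Finset α, (∀ a ∈ X, (X.filter (R a)).card ≤ D) → M * (D + 1) ≤ X.card →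
      ∃ Y ⊆ X, M ≤ Y.card ∧ ∀ a ∈ Y, ∀ b ∈ Y, R a b → a = b := by
  classical
  induction M with
  | zero => exact fun X _ _ => ⟨∅, by simp⟩
  | succ M ih =>
    intro X hD hX
    obtain ⟨a, ha⟩ : X.Nonempty := Finset.card_pos.1 (lt_of_lt_of_le (by positivity) hX)
    have hsub : insert a (X.filter (R a)) ⊆ X :=
      Finset.insert_subset ha (Finset.filter_subset _ _)
    have h1 := Finset.card_sdiff_add_card_eq_card hsub
    have h2 := Finset.card_insert_le a (X.filter (R a))
    have h3 := hD a ha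
    obtain ⟨Y, hYX, hY, hind⟩ := ih (X \ insert a (X.filter (R a)))
      (fun b hb => le_trans (Finset.card_le_card
        (Finset.filter_subset_filter _ Finset.sdiff_subset)) (hD b (Finset.mem_sdiff.1 hb).1))
      (by rw [Nat.succ_mul] at hX; omega)
    have hYa : ∀ b ∈ Y, b ≠ a ∧ ¬ R a b := by
      intro b hb
      have := Finset.mem_sdiff.1 (hYX hb)
      simp only [Finset.mem_insert, Finset.mem_filter, not_or, not_and] at this
      exact ⟨this.2.1, this.2.2 this.1⟩
    refine ⟨insert a Y, Finset.insert_subset ha (hYX.trans Finset.sdiff_subset), ?_, ?_⟩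
    · rw [Finset.card_insert_of_notMem fun h => (hYa a h).1 rfl]
      omega
    · intro b hb c hc hbc
      rcases Finset.mem_insert.1 hb with rfl | hb <;> rcases Finset.mem_insert.1 hc with rfl | hc
      · rfl
      · exact absurd hbc (hYa c hc).2
      · exact absurd (hR _ _ hbc) (hYa b ‹_›).2
      · exact hind b hb c hc hbc

/-- Join v and w when some two members of the family collide there. Since each member is injective,
every pair (l, l') gives v at most one neighbour, so a large independent set exists. -/
lemma exists_subset_injective_family {β : Type*} (L : Finset β) (g : β → ℕ → ℕ) (M : ℕ)
    (X : Finset ℕ) (hinj : ∀ l ∈ L, Set.InjOn (g l) X)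
    (hX : M * (L.card * L.card + 1) ≤ X.card) :
    ∃ Y ⊆ X, M ≤ Y.card ∧ ∀ v ∈ Y, ∀ w ∈ Y, ∀ l ∈ L, ∀ l' ∈ L, g l v = g l' w → v = w := by
  classical
  have hdeg : ∀ v ∈ X, (X.filter (fun w => ∃ l ∈ L, ∃ l' ∈ L, g l v = g l' w)).card
      ≤ L.card * L.card := by
    intro v _
    have hsub : X.filter (fun w => ∃ l ∈ L, ∃ l' ∈ L, g l v = g l' w) ⊆
        (L ×ˢ L).biUnion (fun q => X.filter (fun w => g q.1 v = g q.2 w)) := by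
      intro w hw
      obtain ⟨hwX, l, hl, l', hl', e⟩ := Finset.mem_filter.1 hw
      exact Finset.mem_biUnion.2 ⟨(l, l'), Finset.mk_mem_product hl hl',
        Finset.mem_filter.2 ⟨hwX, e⟩⟩
    refine (Finset.card_le_card hsub).trans ?_
    refine (Finset.card_biUnion_le_card_mul _ _ 1 fun q hq => ?_).trans (by simp)
    rw [Finset.card_le_one]
    intro w hw w' hw'
    rw [Finset.mem_filter] at hw hw'
    exact hinj q.2 (Finset.mem_product.1 hq).2 hw.1 hw'.1 (hw.2.symm.trans hw'.2)
  obtain ⟨Y, hYX, hY, h⟩ := exists_independent_subset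
    (fun v w => ∃ l ∈ L, ∃ l' ∈ L, g l v = g l' w)
    (fun v w ⟨l, hl, l', hl', h⟩ => ⟨l', hl', l, hl, h.symm⟩) (L.card * L.card) M X hdeg hX
  exact ⟨Y, hYX, hY, fun v hv w hw l hl l' hl' e => h v hv w hw ⟨l, hl, l', hl', e⟩⟩

/-- After shrinking coordinate i, u is constant or injective on every line in direction i.
Two-colouring the grid by this alternative and passing to a monochromatic subgrid makes it uniform.
All constant means independence; all injective leads to determination once collisions between
different lines are removed. -/
lemma forcible_indepCoord_or_determinesCoord {ι : Type*} [Fintype ι] [DecidableEq ι] (i : ι) :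
    Forcible (fun (u : (ι → ℕ) → ℕ) Y => IndepCoord i u Y ∨ DeterminesCoord i u Y) := by
  classical
  intro M
  set D := (M + 1) ^ Fintype.card ι with hD
  set M₁ := M * (D * D + 1) + M with hM₁
  obtain ⟨M₂, h₂⟩ := forcible_const_prop ι M₁
  obtain ⟨N, hN⟩ := exists_forall_const_or_injOn (β := ι → ℕ) ((M₂ + 1) ^ Fintype.card ι) M₂
  refine ⟨N + M₂, fun u X hX => ?_⟩
  obtain ⟨X', L, hX'X, hX'i, hX'c, hLc, hL⟩ :=
    exists_line_representatives i M₂ X fun j => le_trans (Nat.le_add_left _ _) (hX j)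
  obtain ⟨F, hFX, hF, hFL⟩ := hN L (fun l w => u (Function.update l i w)) (X i) hLc
    (le_trans (Nat.le_add_right _ _) (hX i))
  have hsub : ∀ j, Function.update X' i F j ⊆ X' j := by
    intro j
    by_cases hj : j = i
    · subst hj; simpa [hX'i] using hFX
    · simp [hj]
  obtain ⟨Y, hYX, hY, hYc⟩ := h₂
    (fun x => ∀ v ∈ F, ∀ w ∈ F, u (Function.update x i v) = u (Function.update x i w))
    (Function.update X' i F) (fun j => by
      by_cases hj : j = i
      · subst hj; simpa using hF
      · simp [hj, hX'c j hj])
  have hYi : Y i ⊆ F := by simpa using hYX i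
  have hYX' : ∀ j, Y j ⊆ X' j := fun j => (hYX j).trans (hsub j)
  have hcard : ∀ j, M ≤ (Y j).card := fun j => le_trans (by omega) (hY j)
  by_cases hconst : ∃ x : ι → ℕ, (∀ j, x j ∈ Y j) ∧
      ∀ v ∈ F, ∀ w ∈ F, u (Function.update x i v) = u (Function.update x i w)
  · obtain ⟨x₀, hx₀, hx₀c⟩ := hconst
    refine ⟨Y, fun j => (hYX' j).trans (hX'X j), hcard, Or.inl fun x hx w hw => ?_⟩
    have := (hYc x₀ x hx₀ hx).1 hx₀c w (hYi hw) (x i) (hYi (hx i))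
    simpa using this
  push Not at hconst
  obtain ⟨Z, L', hZY, hZi, hZc, hLc', hL'⟩ := exists_line_representatives i M Y hcard
  -- `L'` may contain points that represent no line of Z, where injectivity is unknown; only genuine
  -- representatives are kept.
  set L'' := (Finset.univ.image fun x : (j : ι) → Z j => Function.update (fun j => (x j : ℕ)) i 0)
    with hL''
  have hmem : ∀ x : ι → ℕ, (∀ j, x j ∈ Z j) → Function.update x i 0 ∈ L'' := fun x hx =>
    Finset.mem_image.2 ⟨fun j => ⟨x j, hx j⟩, Finset.mem_univ _, rfl⟩
  have hL''L' : L'' ⊆ L' := by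
    intro l hl
    obtain ⟨x, -, rfl⟩ := Finset.mem_image.1 hl
    exact hL' _ fun j => (x j).2
  have hL''c : L''.card ≤ D := (Finset.card_le_card hL''L').trans hLc'
  have hinj : ∀ l ∈ L'', Set.InjOn (fun w => u (Function.update l i w)) (Z i) := by
    intro l hl
    obtain ⟨x, -, rfl⟩ := Finset.mem_image.1 hl
    have hxY : ∀ j, (x j : ℕ) ∈ Y j := fun j => hZY j (x j).2
    rcases hFL _ (hL _ fun j => hYX' j (hxY j)) with h | h
    · exfalso
      obtain ⟨v, hv, w, hw, hne⟩ := hconst _ hxY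
      exact hne (by simpa using h v hv w hw)
    · exact h.mono ((hZY i).trans hYi)
  obtain ⟨G, hGZ, hG, hGinj⟩ := exists_subset_injective_family L''
    (fun l w => u (Function.update l i w)) M (Z i) hinj (by
      rw [hZi]
      have : L''.card * L''.card ≤ D * D := Nat.mul_le_mul hL''c hL''c
      calc _ ≤ M * (D * D + 1) := Nat.mul_le_mul_left _ (by omega)
        _ ≤ M₁ := by omega
        _ ≤ _ := hY i)
  have hWZ : ∀ j, Function.update Z i G j ⊆ Z j := by
    intro j
    by_cases hj : j = i
    · subst hj; simpa using hGZ
    · simp [hj]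
  refine ⟨Function.update Z i G,
    fun j => (hWZ j).trans ((hZY j).trans ((hYX' j).trans (hX'X j))), ?_, Or.inr ?_⟩
  · intro j
    by_cases hj : j = i
    · subst hj; simpa using hG
    · simp [hj, hZc j hj]
  · intro x y hx hy hxy
    refine hGinj (x i) (by simpa using hx i) (y i) (by simpa using hy i) _
      (hmem x fun j => hWZ j (hx j)) _ (hmem y fun j => hWZ j (hy j)) ?_
    simpa using hxy

/-! ### Edge intersections when all transversals are covered -/

/-- Choose a so that its non-constant entries avoid row 0, hence all constant values, and then b so
that its non-constant entries avoid row a. Each injective column excludes at most one row per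
forbidden value. -/
lemma exists_pair_forall_eq_imp_mem {κ : Type*} [Fintype κ] {N : ℕ}
    (hN : Fintype.card κ * Fintype.card κ + 2 ≤ N) (g : κ → Fin N → ℕ) (C : Finset κ)
    (hconst : ∀ c ∈ C, ∀ a b, g c a = g c b) (hinj : ∀ c ∉ C, Function.Injective (g c))
    (hrow : ∀ a, Function.Injective fun c => g c a) :
    ∃ a b, ∀ c c', g c a = g c' b → c = c' ∧ c ∈ C := by
  classical
  let bad : (κ → ℕ) → Finset (Fin N) := fun v =>
    Finset.univ.filter fun a => ∃ c ∉ C, ∃ c', g c a = v c'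
  have hbad : ∀ v, (bad v).card ≤ Fintype.card κ * Fintype.card κ := by
    intro v
    have hsub : bad v ⊆ (Finset.univ : Finset (κ × κ)).biUnion
        (fun q => Finset.univ.filter fun a => q.1 ∉ C ∧ g q.1 a = v q.2) := by
      intro a ha
      obtain ⟨-, c, hc, c', h⟩ := Finset.mem_filter.1 ha
      exact Finset.mem_biUnion.2 ⟨(c, c'), Finset.mem_univ _, by simp [hc, h]⟩
    refine (Finset.card_le_card hsub).trans ?_
    refine (Finset.card_biUnion_le_card_mul _ _ 1 fun q _ => ?_).trans (by simp)
    rw [Finset.card_le_one]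
    intro a ha b hb
    rw [Finset.mem_filter] at ha hb
    exact hinj q.1 ha.2.1 (ha.2.2.trans hb.2.2.symm)
  have hpick : ∀ v, ∃ a, a ∉ bad v := by
    intro v
    by_contra! h
    have h1 : bad v = Finset.univ := Finset.eq_univ_of_forall h
    have h2 := hbad v
    rw [h1, Finset.card_univ, Fintype.card_fin] at h2
    omega
  obtain ⟨a, ha⟩ := hpick fun c => g c ⟨0, by omega⟩
  obtain ⟨b, hb⟩ := hpick fun c => g c a
  refine ⟨a, b, fun c c' h => ?_⟩
  have hc' : c' ∈ C := by
    by_contra hc'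
    exact hb (Finset.mem_filter.2 ⟨Finset.mem_univ _, c', hc', c, h.symm⟩)
  have hc : c ∈ C := by
    by_contra hc
    exact ha (Finset.mem_filter.2
      ⟨Finset.mem_univ _, c, hc, c', h.trans (hconst c' hc' _ _)⟩)
  exact ⟨hrow b ((hconst c hc b a).trans h), hc⟩

/-- A `2m`-set containing an injective `m`-tuple is enumerated by it and a second `m`-tuple. -/
lemma exists_enumeration {m : ℕ} {e : Finset ℕ} (he : e.card = 2 * m) {x : Fin m → ℕ}
    (hx : Function.Injective x) (hxe : ∀ i, x i ∈ e) :
    ∃ t : Fin m → ℕ, Function.Injective (Sum.elim x t) ∧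
      e = Finset.univ.image (Sum.elim x t) := by
  have hsub : Finset.univ.image x ⊆ e := by
    intro v hv
    obtain ⟨i, -, rfl⟩ := Finset.mem_image.1 hv
    exact hxe i
  have hcard : (e \ Finset.univ.image x).card = m := by
    have h1 := Finset.card_sdiff_add_card_eq_card hsub
    rw [Finset.card_image_of_injective _ hx, Finset.card_univ, Fintype.card_fin] at h1
    omega
  have hmem : ∀ j, (e \ Finset.univ.image x).orderEmbOfFin hcard j ∈ e \ Finset.univ.image x :=
    fun j => Finset.orderEmbOfFin_mem _ _ _
  have hinj : Function.Injective
      (Sum.elim x ((e \ Finset.univ.image x).orderEmbOfFin hcard)) := by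
    refine hx.sumElim (RelEmbedding.injective _) fun i j h => ?_
    exact (Finset.mem_sdiff.1 (hmem j)).2 (h ▸ Finset.mem_image_of_mem x (Finset.mem_univ i))
  refine ⟨_, hinj, (Finset.eq_of_subset_of_card_le ?_ ?_).symm⟩
  · intro v hv
    obtain ⟨i | j, -, rfl⟩ := Finset.mem_image.1 hv
    · exact hxe i
    · exact (Finset.mem_sdiff.1 (hmem j)).1
  · rw [Finset.card_image_of_injective _ hinj, Finset.card_univ, Fintype.card_sum,
      Fintype.card_fin, he, two_mul]

/-- Finitely many functions on a large grid can be made canonical on a large subgrid: each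
coordinate is irrelevant for or determined by each of the functions. -/
lemma forcible_canonical (m r : ℕ) :
    Forcible (fun (u : Fin r → (Fin m → ℕ) → ℕ) Y =>
      ∀ i j, IndepCoord i (u j) Y ∨ DeterminesCoord i (u j) Y) := by
  have h := Forcible.forall_mem (κ := Fin m × Fin r)
    (P := fun q (u : Fin r → (Fin m → ℕ) → ℕ) Y =>
      IndepCoord q.1 (u q.2) Y ∨ DeterminesCoord q.1 (u q.2) Y)
    (fun q M => by
      obtain ⟨N, hN⟩ := forcible_indepCoord_or_determinesCoord q.1 M
      exact ⟨N, fun u => hN (u q.2)⟩)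
    (fun q u X Y hYX => Or.imp (hereditaryOnGrids_indepCoord q.1 (u q.2) X Y hYX)
      (hereditaryOnGrids_determinesCoord q.1 (u q.2) X Y hYX)) Finset.univ
  intro M
  obtain ⟨N, hN⟩ := h M
  refine ⟨N, fun u X hX => ?_⟩
  obtain ⟨Y, hYX, hY, hP⟩ := hN u X hX
  exact ⟨Y, hYX, hY, fun i j => hP (i, j) (Finset.mem_univ _)⟩

/-- Let `E` be a family of `2m`-sets covering all transversals of `m` large disjoint sets.
Then two members of `E` meet in `0` or in `m` elements. -/
theorem exists_card_inter_of_cover_transversals (m : ℕ) :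
    ∃ N : ℕ, ∀ (E : Set (Finset ℕ)) (X : Fin m → Finset ℕ), (∀ e ∈ E, e.card = 2 * m) →
      (∀ i j, i ≠ j → Disjoint (X i) (X j)) → (∀ i, N ≤ (X i).card) →
      (∀ x : Fin m → ℕ, (∀ i, x i ∈ X i) → ∃ e ∈ E, ∀ i, x i ∈ e) →
      ∃ e₁ ∈ E, ∃ e₂ ∈ E, (e₁ ∩ e₂).card = 0 ∨ (e₁ ∩ e₂).card = m := by
  classical
  set M := Fintype.card (Fin m ⊕ Fin m) * Fintype.card (Fin m ⊕ Fin m) + 2 with hM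
  obtain ⟨N, hN⟩ := forcible_canonical m m M
  refine ⟨N, fun E X hE hdisj hX hcov => ?_⟩
  have henum : ∀ x : Fin m → ℕ, ∃ t : Fin m → ℕ, (∀ i, x i ∈ X i) →
      Function.Injective (Sum.elim x t) ∧ Finset.univ.image (Sum.elim x t) ∈ E := by
    intro x
    by_cases hx : ∀ i, x i ∈ X i
    · obtain ⟨e, heE, hxe⟩ := hcov x hx
      have hinj : Function.Injective x := by
        intro i j hij
        by_contra hne
        exact Finset.disjoint_left.1 (hdisj i j hne) (hx i) (hij ▸ hx j)
      obtain ⟨t, ht, rfl⟩ := exists_enumeration (hE e heE) hinj hxe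
      exact ⟨t, fun _ => ⟨ht, heE⟩⟩
    · exact ⟨x, fun h => absurd h hx⟩
  choose t ht using henum
  obtain ⟨Y, hYX, hY, hcan⟩ := hN (fun j x => t x j) X hX
  set J : Fin m → Finset (Fin m) := fun j =>
    Finset.univ.filter fun i => ¬ IndepCoord i (fun x => t x j) Y with hJ
  have key : ∀ Q : Finset (Fin m), ∃ e₁ ∈ E, ∃ e₂ ∈ E, (e₁ ∩ e₂).card =
      Q.card + (Finset.univ.filter fun j => J j ⊆ Q).card := by
    intro Q
    set val : ∀ i, Fin M ↪o ℕ := fun i => (Y i).orderEmbOfCardLe (hY i) with hval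
    -- M transversals that agree on Q and are pairwise different in every other coordinate.
    set y : Fin M → Fin m → ℕ := fun a i => if i ∈ Q then val i ⟨0, by omega⟩ else val i a with hy
    have hyY : ∀ a i, y a i ∈ Y i := by
      intro a i
      simp only [hy]
      split_ifs <;> exact Finset.orderEmbOfCardLe_mem _ _ _
    have hyX : ∀ a i, y a i ∈ X i := fun a i => hYX i (hyY a i)
    have hyinj : ∀ i ∉ Q, ∀ a b, y a i = y b i → a = b := by
      intro i hi a b h
      simp only [hy, hi, if_false] at h
      exact (val i).injective h
    set C : Finset (Fin m ⊕ Fin m) := Q.disjSum (Finset.univ.filter fun j => J j ⊆ Q) with hC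
    set g : Fin m ⊕ Fin m → Fin M → ℕ := fun c a => Sum.elim (y a) (t (y a)) c with hg
    have hrow : ∀ a, Function.Injective fun c => g c a := fun a => (ht (y a) (hyX a)).1
    have hconst : ∀ c ∈ C, ∀ a b, g c a = g c b := by
      rintro (i | j) hc a b
      · have hi : i ∈ Q := by simpa [hC] using hc
        simp [hg, hy, hi]
      · have hj : J j ⊆ Q := by simpa [hC] using hc
        refine eq_of_indepCoord (f := fun x => t x j) (Y := Y) (D := Q) (fun i hi => ?_)
          (hyY a) (hyY b) (fun i hi => by simp [hy, hi])
        by_contra hni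
        exact hi (hj (Finset.mem_filter.2 ⟨Finset.mem_univ _, hni⟩))
    have hinj : ∀ c ∉ C, Function.Injective (g c) := by
      rintro (i | j) hc a b hab
      · have hi : i ∉ Q := by simpa [hC] using hc
        exact hyinj i hi a b hab
      · have hj : ¬ J j ⊆ Q := by simpa [hC] using hc
        obtain ⟨i, hiJ, hiQ⟩ := Finset.not_subset.1 hj
        have hdet := (hcan i j).resolve_left (Finset.mem_filter.1 hiJ).2
        exact hyinj i hiQ a b (hdet _ _ (hyY a) (hyY b) hab)
    obtain ⟨a, b, hab⟩ := exists_pair_forall_eq_imp_mem le_rfl g C hconst hinj hrow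
    refine ⟨_, (ht (y a) (hyX a)).2, _, (ht (y b) (hyX b)).2, ?_⟩
    have hinter : Finset.univ.image (Sum.elim (y a) (t (y a))) ∩
        Finset.univ.image (Sum.elim (y b) (t (y b))) = C.image fun c => g c a := by
      ext v
      simp only [Finset.mem_inter, Finset.mem_image, Finset.mem_univ, true_and]
      constructor
      · rintro ⟨⟨c, rfl⟩, c', hc'⟩
        exact ⟨c, (hab c c' hc'.symm).2, rfl⟩
      · rintro ⟨c, hc, rfl⟩
        exact ⟨⟨c, rfl⟩, c, hconst c hc b a⟩
    rw [hinter, Finset.card_image_of_injective _ (hrow a), hC, Finset.card_disjSum]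
  set p := (Finset.univ.filter fun j => J j = ∅).card with hp
  have hsplit : p + (Finset.univ.filter fun j => J j ≠ ∅).card = m := by
    have := Finset.card_filter_add_card_filter_not (s := (Finset.univ : Finset (Fin m)))
      (fun j => J j = ∅)
    simpa using this
  by_cases hp0 : p = 0
  · obtain ⟨e₁, he₁, e₂, he₂, h⟩ := key ∅
    refine ⟨e₁, he₁, e₂, he₂, Or.inl ?_⟩
    simpa [hp0, ← hp] using h
  -- The p empty sets J j count for every Q, so the remaining fewer than m sets have to supply m -
  -- p.
  · obtain ⟨Q, -, hQ⟩ := exists_card_add_card_filter_subset_eq m Finset.univ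
      (Finset.univ.filter fun j => J j ≠ ∅) J (m - p) (by simp)
      (fun j hj => ⟨Finset.nonempty_iff_ne_empty.2 (Finset.mem_filter.1 hj).2,
        Finset.subset_univ _⟩)
      (by rw [Finset.card_univ, Fintype.card_fin]; omega)
      (by rw [Finset.card_univ, Fintype.card_fin]; omega)
    obtain ⟨e₁, he₁, e₂, he₂, h⟩ := key Q
    refine ⟨e₁, he₁, e₂, he₂, Or.inr ?_⟩
    have hfil : (Finset.univ.filter fun j => J j ⊆ Q).card =
        p + ((Finset.univ.filter fun j => J j ≠ ∅).filter fun j => J j ⊆ Q).card := by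
      rw [← Finset.card_filter_add_card_filter_not (s := Finset.univ.filter fun j => J j ⊆ Q)
        (fun j => J j = ∅), Finset.filter_filter, Finset.filter_filter, Finset.filter_filter, hp]
      congr 2
      · exact Finset.filter_congr fun j _ => ⟨fun h => h.2, fun h => ⟨by simp [h], h⟩⟩
      · exact Finset.filter_congr fun j _ => and_comm
    omega

/-! ### From minimum degree to covered transversals -/

/-- Two sets of the same type with respect to `A` are interchanged by a permutation fixing `A`. -/
lemma exists_perm_of_card_inter_eq {V : Type*} [Fintype V] [DecidableEq V] {A S S' : Finset V}
    (hA : (S ∩ A).card = (S' ∩ A).card) (hB : (S \ A).card = (S' \ A).card) :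
    ∃ σ : Equiv.Perm V, (∀ v, σ v ∈ A ↔ v ∈ A) ∧ ∀ v, σ v ∈ S' ↔ v ∈ S := by
  -- The permutation is glued from bijections between the four cells cut out by A and S,
  -- respectively A and S'.
  have hfib : ∀ c : Bool × Bool,
      Nonempty ({v // (decide (v ∈ A), decide (v ∈ S)) = c} ≃
        {v // (decide (v ∈ A), decide (v ∈ S')) = c}) := by
    have hA' : (A \ S).card = (A \ S').card := by
      have h1 := Finset.card_sdiff_add_card_inter A S
      have h2 := Finset.card_sdiff_add_card_inter A S'
      rw [Finset.inter_comm] at h1 h2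
      omega
    have hB' : ((S ∪ A)ᶜ).card = ((S' ∪ A)ᶜ).card := by
      rw [Finset.card_compl, Finset.card_compl, ← Finset.sdiff_union_self_eq_union,
        ← Finset.sdiff_union_self_eq_union (s := S'),
        Finset.card_union_of_disjoint Finset.sdiff_disjoint,
        Finset.card_union_of_disjoint Finset.sdiff_disjoint, hB]
    rintro ⟨_ | _, _ | _⟩ <;> refine ⟨Fintype.equivOfCardEq ?_⟩ <;>
      rw [Fintype.card_subtype, Fintype.card_subtype]
    · convert hB' using 2 <;> ext v <;> simp [and_comm]
    · convert hB using 2 <;> ext v <;> simp [and_comm]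
    · convert hA' using 2 <;> ext v <;> simp
    · convert hA using 2 <;> ext v <;> simp [and_comm]
  have F := fun c => (hfib c).some
  refine ⟨Equiv.ofFiberEquiv F, fun v => ?_, fun v => ?_⟩
  · have := congrArg Prod.fst (Equiv.ofFiberEquiv_map F v)
    simpa using this
  · have := congrArg Prod.snd (Equiv.ofFiberEquiv_map F v)
    simpa using this

namespace KGraph

/-- In a `k`-graph whose edges are determined by `|e ∩ A|`, sets of the same type with respect to
`A` have the same degree. -/
lemma degree_eq_of_card_inter_eq {V : Type*} [Fintype V] [DecidableEq V] {k : ℕ}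
    {G : KGraph V k} {A : Finset V} {p : ℕ → Prop}
    (hG : ∀ e, e ∈ G.edges ↔ e.card = k ∧ p (e ∩ A).card) {S S' : Finset V}
    (hA : (S ∩ A).card = (S' ∩ A).card) (hB : (S \ A).card = (S' \ A).card) :
    G.degree S = G.degree S' := by
  obtain ⟨σ, hσA, hσS⟩ := exists_perm_of_card_inter_eq hA hB
  refine Finset.card_equiv σ.finsetCongr fun e => ?_
  have hmapA : (e.map σ.toEmbedding ∩ A).card = (e ∩ A).card := by
    rw [← Finset.card_map (s := e ∩ A) σ.toEmbedding]
    congr 1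
    ext v
    obtain ⟨w, rfl⟩ := σ.surjective v
    simp [hσA]
  have hmapS : S' ⊆ e.map σ.toEmbedding ↔ S ⊆ e := by
    constructor
    · intro h v hv
      simpa using h ((hσS v).2 hv)
    · intro h v hv
      obtain ⟨w, rfl⟩ := σ.surjective v
      simpa using h ((hσS w).1 hv)
  rw [Finset.mem_filter, Finset.mem_filter, Equiv.finsetCongr_apply, hG, hG, hmapA, hmapS,
    Finset.card_map]

/-- If `H` has larger minimum `d`-degree than `G`, then all `d`-sets of a certain type with respect
to `A` are contained in an edge of `H` that is not an edge of `G`. -/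
lemma exists_type_forall_exists_edge {V : Type*} [Fintype V] [DecidableEq V] {k d : ℕ}
    {H G : KGraph V k} {A : Finset V} {p : ℕ → Prop}
    (hG : ∀ e, e ∈ G.edges ↔ e.card = k ∧ p (e ∩ A).card) (hd : d ≤ Fintype.card V)
    (hlt : G.minDegree d < H.minDegree d) :
    ∃ a b : ℕ, a + b = d ∧ ∀ S : Finset V, (S ∩ A).card = a → (S \ A).card = b →
      ∃ e ∈ H.edges, S ⊆ e ∧ ¬ p (e ∩ A).card := by
  obtain ⟨T, -, hT⟩ := Finset.exists_subset_card_eq (s := (Finset.univ : Finset V)) (n := d)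
    (by rwa [Finset.card_univ])
  obtain ⟨S₀, hS₀, hdeg⟩ : G.minDegree d ∈ {m : ℕ | ∃ S : Finset V, S.card = d ∧ G.degree S = m} :=
    Nat.sInf_mem ⟨G.degree T, T, hT, rfl⟩
  have hsum : ∀ S : Finset V, (S ∩ A).card + (S \ A).card = S.card := fun S => by
    rw [add_comm, Finset.card_sdiff_add_card_inter]
  -- The type is that of a d-set of minimum degree in G; all sets of this type have that same
  -- G-degree, which is below their H-degree.
  refine ⟨(S₀ ∩ A).card, (S₀ \ A).card, by rw [hsum, hS₀], fun S hSA hSB => ?_⟩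
  have hS : S.card = d := by rw [← hsum, hSA, hSB, hsum, hS₀]
  have hH : H.minDegree d ≤ H.degree S := Nat.sInf_le ⟨S, hS, rfl⟩
  by_contra! hcon
  have hle : H.degree S ≤ G.degree S := by
    refine Finset.card_le_card fun e he => ?_
    rw [Finset.mem_filter] at he ⊢
    have hek := (Finset.mem_powersetCard.1 (H.edges_subset he.1)).2
    exact ⟨(hG e).2 ⟨hek, hcon e he.1 he.2⟩, he.2⟩
  have := degree_eq_of_card_inter_eq hG hSA hSB
  omega

theorem exists_card_inter_of_minDegree_lt (m d : ℕ) (hm : 0 < m) (hmd : m ≤ d) :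
    ∃ n₀ : ℕ, ∀ (V : Type*) [Fintype V] [DecidableEq V] (H G G' : KGraph V (2 * m))
      (A : Finset V) (p : ℕ → Prop), n₀ ≤ A.card → n₀ ≤ Aᶜ.card →
      (∀ e, e ∈ G.edges ↔ e.card = 2 * m ∧ p (e ∩ A).card) →
      (∀ e, e ∈ G'.edges ↔ e.card = 2 * m ∧ ¬ p (e ∩ A).card) →
      G.minDegree d < H.minDegree d →
        ∃ e₁ ∈ (H.inter G').edges, ∃ e₂ ∈ (H.inter G').edges,
          e₁ ≠ e₂ ∧ ((e₁ ∩ e₂).card = 0 ∨ (e₁ ∩ e₂).card = m) := by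
  obtain ⟨N, hN⟩ := exists_card_inter_of_cover_transversals m
  -- Room on either side of the partition for m blocks of size N, and for completing a transversal
  -- to a d-set of the required type.
  refine ⟨m * N + d, fun V _ _ H G G' A p hA hB hG hG' hlt => ?_⟩
  obtain ⟨a₀, b₀, hab, hcov⟩ := exists_type_forall_exists_edge hG
    (le_trans (by omega) (Finset.card_le_univ A)) hlt
  -- D indexes the blocks placed in A. The other m - min a₀ m blocks number at most b₀, because m ≤
  -- d = a₀ + b₀.
  obtain ⟨D, -, hD⟩ := Finset.exists_subset_card_eq (s := (Finset.univ : Finset (Fin m)))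
    (n := min a₀ m) (by simp)
  have hDc : Dᶜ.card = m - min a₀ m := by rw [Finset.card_compl, hD, Fintype.card_fin]
  obtain ⟨ψA⟩ : Nonempty (Fin m × Fin N ↪ A) :=
    Function.Embedding.nonempty_of_card_le (by simp; omega)
  obtain ⟨ψB⟩ : Nonempty (Fin m × Fin N ↪ (Aᶜ : Finset V)) :=
    Function.Embedding.nonempty_of_card_le (by
      rw [Fintype.card_coe, Fintype.card_prod, Fintype.card_fin, Fintype.card_fin]; omega)
  set f : Fin m → Fin N → V := fun i r => if i ∈ D then ψA (i, r) else ψB (i, r) with hf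
  have hfA : ∀ i r, f i r ∈ A ↔ i ∈ D := by
    intro i r
    by_cases hi : i ∈ D
    · simp [hf, hi]
    · simpa only [hf, hi, if_false, iff_false] using Finset.mem_compl.1 (ψB (i, r)).2
  have hfinj : ∀ i j r s, f i r = f j s → i = j ∧ r = s := by
    intro i j r s h
    have hij : i ∈ D ↔ j ∈ D := by rw [← hfA i r, ← hfA j s, h]
    by_cases hi : i ∈ D
    · have hj := hij.1 hi
      simp only [hf, hi, hj, if_true] at h
      simpa using ψA.injective (Subtype.ext h)
    · have hj : j ∉ D := fun hj => hi (hij.2 hj)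
      simp only [hf, hi, hj, if_false] at h
      simpa using ψB.injective (Subtype.ext h)
  set φ : V ↪ ℕ := (Fintype.equivFin V).toEmbedding.trans Fin.valEmbedding
  suffices hsuff : ∃ e₁ ∈ {e | ∃ e' ∈ (H.inter G').edges, e'.map φ = e},
      ∃ e₂ ∈ {e | ∃ e' ∈ (H.inter G').edges, e'.map φ = e},
        (e₁ ∩ e₂).card = 0 ∨ (e₁ ∩ e₂).card = m by
    obtain ⟨_, ⟨e₁, he₁, rfl⟩, _, ⟨e₂, he₂, rfl⟩, h⟩ := hsuff
    rw [← Finset.map_inter, Finset.card_map] at h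
    refine ⟨e₁, he₁, e₂, he₂, ?_, h⟩
    -- An edge meets itself in 2m vertices, which is neither 0 nor m as m > 0.
    rintro rfl
    have hc := (Finset.mem_powersetCard.1 ((H.inter G').edges_subset he₁)).2
    rw [Finset.inter_self, hc] at h
    omega
  refine hN _ (fun i => Finset.univ.image fun r => φ (f i r)) ?_ ?_ ?_ ?_
  · rintro _ ⟨e, he, rfl⟩
    rw [Finset.card_map]
    exact (Finset.mem_powersetCard.1 ((H.inter G').edges_subset he)).2
  · intro i j hij
    rw [Finset.disjoint_left]
    intro v hv hv'
    obtain ⟨r, -, rfl⟩ := Finset.mem_image.1 hv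
    obtain ⟨s, -, hs⟩ := Finset.mem_image.1 hv'
    exact hij (hfinj i j r s (φ.injective hs.symm)).1
  · intro i
    rw [Finset.card_image_of_injective _ fun r s h => (hfinj i i r s (φ.injective h)).2]
    simp
  · intro x hx
    choose r _ hr using fun i => Finset.mem_image.1 (hx i)
    set S : Finset V := Finset.univ.image fun i => f i (r i) with hS
    have hSA : (S ∩ A).card ≤ a₀ := by
      have hsub : S ∩ A ⊆ D.image fun i => f i (r i) := by
        intro v hv
        obtain ⟨hvS, hvA⟩ := Finset.mem_inter.1 hv
        obtain ⟨i, -, rfl⟩ := Finset.mem_image.1 hvS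
        exact Finset.mem_image_of_mem _ ((hfA i _).1 hvA)
      exact (Finset.card_le_card hsub).trans (Finset.card_image_le.trans (by omega))
    have hSB : (S \ A).card ≤ b₀ := by
      have hsub : S \ A ⊆ Dᶜ.image fun i => f i (r i) := by
        intro v hv
        obtain ⟨hvS, hvA⟩ := Finset.mem_sdiff.1 hv
        obtain ⟨i, -, rfl⟩ := Finset.mem_image.1 hvS
        exact Finset.mem_image_of_mem _ (Finset.mem_compl.2 fun hi => hvA ((hfA i _).2 hi))
      exact (Finset.card_le_card hsub).trans (Finset.card_image_le.trans (by omega))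
    obtain ⟨TA, hSTA, hTAA, hTA⟩ := Finset.exists_subsuperset_card_eq
      (Finset.inter_subset_right : S ∩ A ⊆ A) hSA (by omega)
    obtain ⟨TB, hSTB, hTBB, hTB⟩ := Finset.exists_subsuperset_card_eq
      (show S \ A ⊆ Aᶜ from fun v hv => Finset.mem_compl.2 (Finset.mem_sdiff.1 hv).2) hSB
      (by omega)
    have h1 : (TA ∪ TB) ∩ A = TA := by
      ext v
      have := @hTAA v
      have := @hTBB v
      simp only [Finset.mem_compl, Finset.mem_inter, Finset.mem_union] at *
      tauto
    have h2 : (TA ∪ TB) \ A = TB := by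
      ext v
      have := @hTAA v
      have := @hTBB v
      simp only [Finset.mem_compl, Finset.mem_sdiff, Finset.mem_union] at *
      tauto
    obtain ⟨e, heH, hSe, hpe⟩ := hcov (TA ∪ TB) (by rw [h1, hTA]) (by rw [h2, hTB])
    have hek := (Finset.mem_powersetCard.1 (H.edges_subset heH)).2
    refine ⟨e.map φ, ⟨e, Finset.mem_inter.2 ⟨heH, (hG' e).2 ⟨hek, hpe⟩⟩, rfl⟩, fun i => ?_⟩
    rw [← hr i]
    refine Finset.mem_map_of_mem φ (hSe ?_)
    have hiS : f i (r i) ∈ S := Finset.mem_image_of_mem _ (Finset.mem_univ i)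
    by_cases hi : f i (r i) ∈ A
    · exact Finset.mem_union_left _ (hSTA (Finset.mem_inter.2 ⟨hiS, hi⟩))
    · exact Finset.mem_union_right _ (hSTB (Finset.mem_sdiff.2 ⟨hiS, hi⟩))

end KGraph

theorem lemma1p9 (k d : ℕ) (hk : 4 ≤ k) (hk_even : Even k) (hd : k / 2 ≤ d) :
    ∃ n₀ : ℕ, ∀ (V : Type*) [Fintype V] [DecidableEq V] (H : KGraph V k) (A B : Finset V),
      n₀ ≤ Fintype.card V →
      Disjoint A B → A ∪ B = Finset.univ →
      (0.4 : ℝ) * (Fintype.card V : ℝ) ≤ (A.card : ℝ) →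
      (0.4 : ℝ) * (Fintype.card V : ℝ) ≤ (B.card : ℝ) →
      ((KGraph.oddGraph k A).minDegree d < H.minDegree d →
        ∃ e₁ ∈ (H.inter (KGraph.evenGraph k A)).edges,
        ∃ e₂ ∈ (H.inter (KGraph.evenGraph k A)).edges,
          e₁ ≠ e₂ ∧ ((e₁ ∩ e₂).card = 0 ∨ (e₁ ∩ e₂).card = k / 2)) ∧
      ((KGraph.evenGraph k A).minDegree d < H.minDegree d →
        ∃ e₁ ∈ (H.inter (KGraph.oddGraph k A)).edges,
        ∃ e₂ ∈ (H.inter (KGraph.oddGraph k A)).edges,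
          e₁ ≠ e₂ ∧ ((e₁ ∩ e₂).card = 0 ∨ (e₁ ∩ e₂).card = k / 2)) := by
  obtain ⟨m, rfl⟩ := even_iff_two_dvd.1 hk_even
  rw [Nat.mul_div_cancel_left m two_pos] at hd ⊢
  obtain ⟨n₀, hn₀⟩ := KGraph.exists_card_inter_of_minDegree_lt m d (by omega) hd
  -- The factor 3 suffices since 0.4 · 3 ≥ 1.
  refine ⟨3 * n₀, fun V _ _ H A B hn hdisj hunion hA hB => ?_⟩
  have hBA : Aᶜ = B := (IsCompl.of_eq (Finset.disjoint_iff_inter_eq_empty.1 hdisj) hunion).compl_eq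
  have hbig : ∀ c : ℕ, (0.4 : ℝ) * (Fintype.card V : ℝ) ≤ (c : ℝ) → n₀ ≤ c := by
    intro c hc
    have hn' : (3 : ℝ) * n₀ ≤ Fintype.card V := by exact_mod_cast hn
    have : (n₀ : ℝ) ≤ c := by
      have h0 : (0 : ℝ) ≤ n₀ := Nat.cast_nonneg _
      norm_num at hc
      linarith
    exact_mod_cast this
  have hA' := hbig _ hA
  have hB' : n₀ ≤ Aᶜ.card := hBA ▸ hbig _ hB
  have hodd : ∀ e, e ∈ (KGraph.oddGraph (2 * m) A).edges ↔
      e.card = 2 * m ∧ Odd (e ∩ A).card := fun e => by simp [KGraph.oddGraph]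
  have heven : ∀ e, e ∈ (KGraph.evenGraph (2 * m) A).edges ↔
      e.card = 2 * m ∧ Even (e ∩ A).card := fun e => by simp [KGraph.evenGraph]
  constructor
  · exact hn₀ V H _ _ A Odd hA' hB' hodd (fun e => by rw [heven, Nat.not_odd_iff_even])
  · exact hn₀ V H _ _ A Even hA' hB' heven (fun e => by rw [hodd, Nat.not_even_iff_odd])
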